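/- Let $G$ be a countable group. A finitely generated group $H$ has \emph{subexponential growth} if, for a finite generating set $R$ of $H$ (equivalently, for every such $R$), $$\lim_{n\to\infty}\frac1n\log\bigl|(R\cup R^{-1})^n\bigr|=0,$$ where $(R\cup R^{-1})^n$ denotes the set of all products of $n$ elements of $R\cup R^{-1}$ and $\log 0:=0$ (relevant only for $R=\emptyset$). The group $G$ is \emph{subexponential} if every finitely generated subgroup of $G$ has subexponential growth. Let $G$ act by homeomorphisms on a zero-dimensional compact metric space $X$ (zero-dimensional means that the clopen sets form a basis of the topology). For clopen sets $A,B\subseteq X$, write $A\preccurlyeq B$ if there are a finite partition $A=A_1\sqcup\dots\sqcup A_k$ of $A$ into clopen sets and elements $g_1,\dots,g_k\in G$ such that $g_1(A_1),\dots,g_k(A_k)$ are pairwise disjoint subsets of $B$. (The pieces $A_i$ may be empty, and $k=0$ is allowed when $A=\emptyset$.) The action \emph{admits comparison} if, for all clopen sets $A,B\subseteq X$ such that $\mu(A)<\mu(B)$ for every $G$-invariant Borel probability measure $\mu$ on $X$, one has $A\preccurlyeq B$. The group $G$ has the \emph{comparison property} if every action of $G$ by homeomorphisms on a zero-dimensional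 compact metric space admits comparison. \textbf{Theorem.} Every countable subexponential group has the comparison property. -/

import Mathlib

universe u v

namespace DynamicalComparison

open Filter Topology MeasureTheory
open scoped Pointwise

/-- A finitely generated group has subexponential growth if it has a finite generating set `R`
with `(1 / n) * log |(R ∪ R⁻¹) ^ n| → 0`, where `(R ∪ R⁻¹) ^ n` is the set of all products of `n`
elements of `R ∪ R⁻¹`. -/
def HasSubexponentialGrowth (G : Type*) [Group G] : Prop :=
  ∃ R : Set G, R.Finite ∧ Subgroup.closure R = ⊤ ∧
    Tendsto (fun n : ℕ => 1 / (n : ℝ) * Real.log (((R ∪ R⁻¹) ^ n).ncard : ℝ)) atTop (𝓝 0)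

/-- A group is subexponential if each of its finitely generated subgroups has subexponential
growth. -/
def IsSubexponential (G : Type*) [Group G] : Prop :=
  ∀ H : Subgroup G, H.FG → HasSubexponentialGrowth H

/-- A topological space is zero-dimensional if its clopen sets form a basis of the topology. -/
def IsZeroDimensional (X : Type*) [TopologicalSpace X] : Prop :=
  TopologicalSpace.IsTopologicalBasis {U : Set X | IsClopen U}

/-- `A` is subequivalent to `B`: there are a finite partition of `A` into clopen sets
`A₁, …, Aₖ` and `g₁, …, gₖ` in `G` such that `g₁ A₁, …, gₖ Aₖ` are pairwise disjoint subsets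
of `B`. -/
def IsSubequivalent (G : Type*) [Group G] {X : Type*} [TopologicalSpace X] [MulAction G X]
    (A B : Set X) : Prop :=
  ∃ (k : ℕ) (P : Fin k → Set X) (g : Fin k → G),
    (∀ i, IsClopen (P i)) ∧
    (∀ i j, i ≠ j → Disjoint (P i) (P j)) ∧
    (⋃ i, P i) = A ∧
    (∀ i, g i • P i ⊆ B) ∧
    (∀ i j, i ≠ j → Disjoint (g i • P i) (g j • P j))

/-- The action of `G` on `X` admits comparison: whenever `A`, `B` are clopen and `μ A < μ B` for
every `G`-invariant Borel probability measure `μ`, the set `A` is subequivalent to `B`. -/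
def AdmitsComparison (G : Type*) [Group G] (X : Type*) [TopologicalSpace X] [MeasurableSpace X]
    [BorelSpace X] [MulAction G X] : Prop :=
  ∀ A B : Set X, IsClopen A → IsClopen B →
    (∀ μ : Measure X, IsProbabilityMeasure μ → SMulInvariantMeasure G X μ → μ A < μ B) →
    IsSubequivalent G A B

/-- `G` has the comparison property: every action of `G` by homeomorphisms on a zero-dimensional
compact metric space admits comparison. -/
def HasComparisonProperty (G : Type u) [Group G] : Prop :=
  ∀ (X : Type v) [MetricSpace X] [CompactSpace X] [MeasurableSpace X] [BorelSpace X]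
    [MulAction G X] [ContinuousConstSMul G X],
    IsZeroDimensional X → AdmitsComparison G X

end DynamicalComparison

/-!
Suppose that `μ A < μ B` for every invariant probability measure `μ`. Almost invariant finite
sets occur among the powers of a finite subset of a subexponential group. If along each of these
some point visited `A` at least as often as `B`, a weak limit of the corresponding empirical
measures would be an invariant measure with `μ B ≤ μ A`. Hence there is one finite set
`F` such that every point visits `B` along `F` more often than `A`
(`IsSubexponential.exists_window`).

Join `x ∈ A` to `b ∈ B` if `b = f * f'⁻¹ • x` for some `f, f' ∈ F`. Counting visits, every finite
subset of `A` has at least `c` times as many neighbours in `B`, with a fixed `c > 1`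
(`card_targets_of_window`). With respect to any partial matching of `A` into `B` along these edges,
the points reached by alternating paths from a given point thus grow exponentially until an unused
point of `B` is met. They lie in sets `T ^ n • x` of subexponential size, so an alternating path to
an unused point exists from every `x ∈ A`, of length bounded independently of `x` and of the
matching.

It remains to perform the augmentations along alternating paths for all points at once, keeping the
matching clopen. This is a version of the Hopcroft-Karp algorithm. The points of `B` are labelled by
the length of a shortest alternating path with respect to the current matching. An augmentation
along a shortest path keeps these labels valid as lower bounds and creates no new shortest path
(`IsLabelling.push`, `AltPath.of_push`). Shortest paths given by the same word of group elements are
disjoint, so they may be augmented simultaneously (`IsMatching.exists_augment`), even where the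
action is not free. After finitely many words no path of the current minimal length is left at
unmatched points (`IsMatching.exists_phase`). By the uniform bound on the lengths, finitely many
such phases match all of `A` (`exists_isMatching_unmatched_eq_empty`), and a clopen matching defined
on all of `A` is a subequivalence.
-/

namespace DynamicalComparison

open Filter Topology MeasureTheory
open scoped Pointwise

/-! ### Growth of finite subsets -/

theorem exists_mem_pow_of_closure_eq_top {H : Type*} [Group H] {R : Set H}
    (hR : Subgroup.closure R = ⊤) (x : H) : ∃ i : ℕ, x ∈ (R ∪ R⁻¹) ^ i := by
  have hx : x ∈ Submonoid.closure (R ∪ R⁻¹) := by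
    rw [← Subgroup.closure_toSubmonoid, hR]; trivial
  induction hx using Submonoid.closure_induction with
  | mem x hx => exact ⟨1, by simpa using hx⟩
  | one => exact ⟨0, by simp⟩
  | mul x y _ _ hx hy =>
    obtain ⟨i, hi⟩ := hx
    obtain ⟨j, hj⟩ := hy
    exact ⟨i + j, by rw [pow_add]; exact Set.mul_mem_mul hi hj⟩

/-- If the exponential growth rate of `s` is zero, then `s n = O(a ^ n)` for all `a > 1`; the
constant is adjusted so that the bound holds for all `n`. -/
theorem exists_le_mul_pow_of_tendsto {s : ℕ → ℕ}
    (hs : Tendsto (fun n : ℕ => 1 / (n : ℝ) * Real.log (s n : ℝ)) atTop (𝓝 0))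
    {a : ℝ} (ha : 1 < a) : ∃ C : ℝ, 0 < C ∧ ∀ n, (s n : ℝ) ≤ C * a ^ n := by
  have hev : ∀ᶠ n : ℕ in atTop, (s n : ℝ) ≤ a ^ n := by
    filter_upwards [hs.eventually (gt_mem_nhds (Real.log_pos ha)), eventually_gt_atTop 0]
      with n hn hn0
    have hn0' : (0 : ℝ) < n := by exact_mod_cast hn0
    rcases Nat.eq_zero_or_pos (s n) with h0 | h0
    · rw [h0]; push_cast; positivity
    · have h0' : (0 : ℝ) < s n := by exact_mod_cast h0
      rw [← Real.log_le_log_iff h0' (by positivity), Real.log_pow]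
      rw [one_div, inv_mul_lt_iff₀ hn0'] at hn
      exact hn.le
  obtain ⟨n₀, hn₀⟩ := eventually_atTop.1 hev
  refine ⟨1 + ∑ i ∈ Finset.range n₀, (s i : ℝ), by positivity, fun n => ?_⟩
  have hsum : (0 : ℝ) ≤ ∑ i ∈ Finset.range n₀, (s i : ℝ) := by positivity
  have h1 : 1 ≤ a ^ n := one_le_pow₀ ha.le
  rcases le_or_gt n₀ n with h | h
  · calc (s n : ℝ) ≤ 1 * a ^ n := by rw [one_mul]; exact hn₀ n h
      _ ≤ _ := by gcongr; linarith
  · have : (s n : ℝ) ≤ ∑ i ∈ Finset.range n₀, (s i : ℝ) :=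
      Finset.single_le_sum (f := fun i => (s i : ℝ)) (fun _ _ => by positivity)
        (Finset.mem_range.2 h)
    calc (s n : ℝ) ≤ (1 + ∑ i ∈ Finset.range n₀, (s i : ℝ)) * 1 := by linarith
      _ ≤ _ := by gcongr

theorem exists_mul_pow_lt_pow (j : ℕ) (C : ℝ) {b c : ℝ} (hb : 0 ≤ b) (hbc : b < c) :
    ∃ n : ℕ, ((j * n + 1 : ℕ) : ℝ) * (C * b ^ n) < c ^ n := by
  have hc : 0 < c := hb.trans_lt hbc
  have h0 : 0 ≤ b / c := by positivity
  have h1 : b / c < 1 := (div_lt_one hc).2 hbc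
  have hlim : Tendsto (fun n : ℕ => C * j * (n * (b / c) ^ n) + C * (b / c) ^ n) atTop
      (𝓝 (C * j * 0 + C * 0)) :=
    ((tendsto_self_mul_const_pow_of_lt_one h0 h1).const_mul _).add
      ((tendsto_pow_atTop_nhds_zero_of_lt_one h0 h1).const_mul _)
  have hlt : C * j * 0 + C * 0 < (1 : ℝ) := by norm_num
  obtain ⟨n, hn⟩ := (hlim.eventually (gt_mem_nhds hlt)).exists
  refine ⟨n, ?_⟩
  rw [← sub_pos] at hn ⊢
  have : c ^ n - ((j * n + 1 : ℕ) : ℝ) * (C * b ^ n)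
      = c ^ n * (1 - (C * j * (n * (b / c) ^ n) + C * (b / c) ^ n)) := by
    push_cast
    rw [div_pow]
    field_simp
  rw [this]
  exact mul_pos (pow_pos hc n) hn

/-- In a subexponential group, the powers of a finite set have subexponential size. -/
theorem IsSubexponential.exists_card_pow_lt {G : Type*} [Group G] [DecidableEq G]
    (hG : IsSubexponential G) (T : Finset G) {c : ℝ} (hc : 1 < c) :
    ∃ n : ℕ, ((T ^ n).card : ℝ) < c ^ n := by
  obtain ⟨R, hRfin, hR, hlim⟩ := hG (Subgroup.closure (T : Set G)) ⟨T, rfl⟩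
  set S := R ∪ R⁻¹ with hS
  have hSfin : ∀ i, (S ^ i).Finite := fun i => by
    induction i with
    | zero => simp
    | succ i ih => rw [pow_succ]; exact ih.mul (hRfin.union hRfin.inv)
  have hT : ∃ j, ∀ t ∈ T, ∃ i ≤ j, t ∈ Subtype.val '' (S ^ i) := by
    have h : ∀ t : T, ∃ i, (t : G) ∈ Subtype.val '' (S ^ i) := fun t => by
      obtain ⟨i, hi⟩ := exists_mem_pow_of_closure_eq_top hR ⟨t, Subgroup.subset_closure t.2⟩
      exact ⟨i, _, hi, rfl⟩
    choose l hl using h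
    exact ⟨Finset.univ.sup l, fun t ht =>
      ⟨l ⟨t, ht⟩, Finset.le_sup (Finset.mem_univ _), hl ⟨t, ht⟩⟩⟩
  obtain ⟨j, hj⟩ := hT
  have hTn : ∀ n, ∀ x ∈ T ^ n, ∃ i ≤ j * n, x ∈ Subtype.val '' (S ^ i) := by
    intro n
    induction n with
    | zero => exact fun x hx => ⟨0, by simp, 1, by simp, by simpa [eq_comm] using hx⟩
    | succ n ih =>
      intro x hx
      rw [pow_succ, Finset.mem_mul] at hx
      obtain ⟨y, hy, t, ht, rfl⟩ := hx
      obtain ⟨i, hi, y', hy', rfl⟩ := ih y hy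
      obtain ⟨k, hk, t', ht', rfl⟩ := hj t ht
      refine ⟨i + k, by rw [mul_add]; omega, y' * t', ?_, rfl⟩
      rw [pow_add]
      exact Set.mul_mem_mul hy' ht'
  -- The growth rate of `S` per letter must be chosen below the `j`-th root of `c`.
  obtain ⟨a, ha, hac⟩ : ∃ a : ℝ, 1 < a ∧ a ^ j < c := by
    have h : ∀ᶠ a in 𝓝[>] (1 : ℝ), a ^ j < c :=
      nhdsWithin_le_nhds <| (continuous_pow j).continuousAt.eventually
        (gt_mem_nhds (by simpa using hc))
    obtain ⟨a, h1, h2⟩ := (h.and self_mem_nhdsWithin).exists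
    exact ⟨a, h2, h1⟩
  obtain ⟨C, hC, hCs⟩ := exists_le_mul_pow_of_tendsto hlim ha
  obtain ⟨n, hn⟩ := exists_mul_pow_lt_pow j C (b := a ^ j) (by positivity) hac
  refine ⟨n, lt_of_le_of_lt ?_ hn⟩
  have hsub : T ^ n ⊆ (Finset.range (j * n + 1)).biUnion
      fun i => ((hSfin i).image Subtype.val).toFinset := by
    intro x hx
    obtain ⟨i, hi, hxi⟩ := hTn n x hx
    simp only [Finset.mem_biUnion, Finset.mem_range, Set.Finite.mem_toFinset]
    exact ⟨i, by omega, hxi⟩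
  have hcard : ∀ i ∈ Finset.range (j * n + 1),
      (((hSfin i).image Subtype.val).toFinset.card : ℝ) ≤ C * (a ^ j) ^ n := by
    intro i hi
    rw [← Set.ncard_eq_toFinset_card _ ((hSfin i).image Subtype.val)]
    calc ((Subtype.val '' (S ^ i)).ncard : ℝ) ≤ (S ^ i).ncard := by
          exact_mod_cast Set.ncard_image_le (hSfin i)
      _ ≤ C * a ^ i := hCs i
      _ ≤ C * (a ^ j) ^ n := by
        rw [← pow_mul]
        have := Finset.mem_range.1 hi
        gcongr
        · exact ha.le
        · omega
  calc ((T ^ n).card : ℝ)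
      ≤ ∑ i ∈ Finset.range (j * n + 1), (((hSfin i).image Subtype.val).toFinset.card : ℝ) := by
        exact_mod_cast (Finset.card_le_card hsub).trans Finset.card_biUnion_le
    _ ≤ _ := by
        refine (Finset.sum_le_card_nsmul _ _ _ hcard).trans_eq ?_
        rw [Finset.card_range, nsmul_eq_mul]

/-- Powers of a finite set in a subexponential group provide almost invariant finite sets. -/
theorem IsSubexponential.exists_almost_invariant {G : Type*} [Group G] [DecidableEq G]
    (hG : IsSubexponential G) (T : Finset G) {ε : ℝ} (hε : 0 < ε) :
    ∃ F : Finset G, F.Nonempty ∧ ∀ t ∈ T, ((t • F \ F).card : ℝ) ≤ ε * F.card := by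
  set T' := insert 1 T with hT'
  have h1 : (1 : G) ∈ T' := Finset.mem_insert_self _ _
  obtain ⟨n, hn⟩ : ∃ n, ((T' ^ (n + 1)).card : ℝ) ≤ (1 + ε) * (T' ^ n).card := by
    by_contra! hcon
    obtain ⟨n, hn⟩ := hG.exists_card_pow_lt T' (c := 1 + ε) (by linarith)
    refine hn.not_ge ?_
    clear hn
    induction n with
    | zero => simp
    | succ n ih =>
      rw [pow_succ']
      exact (mul_le_mul_of_nonneg_left ih (by positivity)).trans (hcon n).le
  refine ⟨T' ^ n, ⟨1, Finset.one_mem_pow h1⟩, fun t ht => ?_⟩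
  have hsub : T' ^ n ⊆ T' ^ (n + 1) := Finset.pow_subset_pow_right h1 n.le_succ
  have hsub' : t • T' ^ n ⊆ T' ^ (n + 1) := by
    rw [pow_succ']
    exact Finset.smul_finset_subset_mul (Finset.mem_insert_of_mem ht)
  have := Finset.card_le_card (Finset.sdiff_subset_sdiff hsub' (le_refl (T' ^ n)))
  rw [Finset.card_sdiff_of_subset hsub] at this
  have h2 : ((t • T' ^ n \ T' ^ n).card : ℝ) ≤ (T' ^ (n + 1)).card - (T' ^ n).card := by
    rw [← Nat.cast_sub (Finset.card_le_card hsub)]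
    exact_mod_cast this
  linarith

/-! ### Invariant measures as limits of empirical measures -/

open scoped ENNReal

/-- The uniform distribution on the points `f • z`, `f ∈ F`, counted with multiplicity. -/
noncomputable def empiricalMeasure {G X : Type*} [SMul G X] [MeasurableSpace X]
    (F : Finset G) (z : X) : Measure X :=
  (F.card : ℝ≥0∞)⁻¹ • ∑ f ∈ F, Measure.dirac (f • z)

open scoped Classical in
theorem empiricalMeasure_apply {G X : Type*} [SMul G X] [MeasurableSpace X]
    (F : Finset G) (z : X) {A : Set X} (hA : MeasurableSet A) :
    empiricalMeasure F z A = (F.card : ℝ≥0∞)⁻¹ * ((F.filter fun f => f • z ∈ A).card : ℝ≥0∞) := by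
  simp [empiricalMeasure, Measure.dirac_apply' _ hA, Set.indicator_apply]

theorem isProbabilityMeasure_empiricalMeasure {G X : Type*} [SMul G X] [MeasurableSpace X]
    {F : Finset G} (hF : F.Nonempty) (z : X) : IsProbabilityMeasure (empiricalMeasure F z) := by
  classical
  refine ⟨?_⟩
  rw [empiricalMeasure_apply F z MeasurableSet.univ]
  simp only [Set.mem_univ, Finset.filter_true]
  exact ENNReal.inv_mul_cancel (by simpa using hF.ne_empty) (ENNReal.natCast_ne_top _)

theorem empiricalMeasure_preimage_smul_le {G X : Type*} [Group G] [DecidableEq G] [MulAction G X]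
    [MeasurableSpace X] [MeasurableConstSMul G X] {F : Finset G} (hF : F.Nonempty) (z : X) {g : G}
    {n : ℕ} (hg : (n + 1) * (g • F \ F).card ≤ F.card) {A : Set X} (hA : MeasurableSet A) :
    empiricalMeasure F z ((g • ·) ⁻¹' A) ≤ empiricalMeasure F z A + (n + 1 : ℝ≥0∞)⁻¹ := by
  classical
  rw [empiricalMeasure_apply F z hA, empiricalMeasure_apply F z (measurable_const_smul g hA)]
  have h1 : (F.filter fun f => f • z ∈ (g • ·) ⁻¹' A).card
      ≤ (F.filter fun f => f • z ∈ A).card + (g • F \ F).card := by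
    rw [← Finset.card_smul_finset g (F.filter _)]
    refine (Finset.card_le_card ?_).trans (Finset.card_union_le _ _)
    intro h hh
    obtain ⟨f, hf, rfl⟩ := Finset.mem_smul_finset.1 hh
    obtain ⟨hfF, hfA⟩ := Finset.mem_filter.1 hf
    by_cases hmem : g • f ∈ F
    · refine Finset.mem_union_left _ (Finset.mem_filter.2 ⟨hmem, ?_⟩)
      rw [smul_assoc]
      exact hfA
    · exact Finset.mem_union_right _
        (Finset.mem_sdiff.2 ⟨Finset.smul_mem_smul_finset hfF, hmem⟩)
  have hF0 : (F.card : ℝ≥0∞) ≠ 0 := by simpa using hF.ne_empty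
  have h2 : (F.card : ℝ≥0∞)⁻¹ * ((g • F \ F).card : ℝ≥0∞) ≤ (n + 1 : ℝ≥0∞)⁻¹ := by
    rw [ENNReal.inv_mul_le_iff hF0 (ENNReal.natCast_ne_top _), ← div_eq_mul_inv,
      ENNReal.le_div_iff_mul_le (by simp) (by simp), mul_comm]
    exact_mod_cast hg
  calc _ ≤ (F.card : ℝ≥0∞)⁻¹ *
        ((F.filter fun f => f • z ∈ A).card + (g • F \ F).card : ℝ≥0∞) := by
        gcongr
        exact_mod_cast h1
    _ ≤ _ := by
        rw [mul_add]
        gcongr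

/-- On a zero-dimensional space, invariance of a measure can be tested on clopen sets, and one
inequality suffices. -/
theorem smulInvariantMeasure_of_isClopen {G X : Type*} [Group G] [MetricSpace X] [CompactSpace X]
    [MeasurableSpace X] [BorelSpace X] [MulAction G X] [ContinuousConstSMul G X]
    (hX : IsZeroDimensional X) (μ : Measure X) [IsProbabilityMeasure μ]
    (h : ∀ (g : G) (A : Set X), IsClopen A → μ ((g • ·) ⁻¹' A) ≤ μ A) :
    SMulInvariantMeasure G X μ := by
  have heq : ∀ (g : G) (A : Set X), IsClopen A → μ ((g • ·) ⁻¹' A) = μ A := by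
    refine fun g A hA => (h g A hA).antisymm ?_
    have := h g⁻¹ _ (hA.preimage (continuous_const_smul g))
    rwa [← Set.preimage_comp, show (g • ·) ∘ (g⁻¹ • ·) = (id : X → X) from funext fun x => by simp,
      Set.preimage_id] at this
  refine ⟨fun g s hs => ?_⟩
  have hm : Measurable (g • · : X → X) := (continuous_const_smul g).measurable
  have hprob : IsProbabilityMeasure (μ.map (g • ·)) :=
    Measure.isProbabilityMeasure_map hm.aemeasurable
  have hmap : μ.map (g • ·) = μ := by
    refine ext_of_generate_finite {U : Set X | IsClopen U} ?_ ?_ ?_ ?_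
    · rw [BorelSpace.measurable_eq (α := X)]
      exact hX.borel_eq_generateFrom
    · exact fun A hA B hB _ => IsClopen.inter hA hB
    · intro A hA
      rw [Measure.map_apply hm (IsClopen.isOpen hA).measurableSet, heq g A hA]
    · rw [measure_univ, measure_univ]
  rw [← Measure.map_apply hm hs, hmap]

open scoped Classical in
/-- The comparison of all invariant measures of `A` and `B` is witnessed by a single finite set
`F`: every point visits `B` along `F` more often than it visits `A`. Otherwise empirical measures
along almost invariant sets accumulate at an invariant measure violating the comparison. -/
theorem IsSubexponential.exists_window {G X : Type*} [Group G] (hG : IsSubexponential G)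
    [MetricSpace X] [CompactSpace X]
    [MeasurableSpace X] [BorelSpace X] [MulAction G X] [ContinuousConstSMul G X]
    (hX : IsZeroDimensional X) {A B : Set X} (hA : IsClopen A) (hB : IsClopen B)
    (hAB : ∀ μ : Measure X, IsProbabilityMeasure μ → SMulInvariantMeasure G X μ → μ A < μ B) :
    ∃ F : Finset G, ∀ z : X,
      (F.filter fun f => f • z ∈ A).card < (F.filter fun f => f • z ∈ B).card := by
  by_contra! hcon
  have hF : ∀ p : Finset G × ℕ, ∃ F : Finset G, F.Nonempty ∧
      ∀ t ∈ p.1, (p.2 + 1) * (t • F \ F).card ≤ F.card := by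
    intro p
    obtain ⟨F, hF, h⟩ := hG.exists_almost_invariant p.1 (ε := ((p.2 + 1 : ℕ) : ℝ)⁻¹) (by positivity)
    refine ⟨F, hF, fun t ht => ?_⟩
    have := h t ht
    rw [inv_mul_eq_div, le_div_iff₀ (by positivity), mul_comm] at this
    exact_mod_cast this
  choose F hFne hF using hF
  choose z hz using fun p => hcon (F p)
  let m : Finset G × ℕ → ProbabilityMeasure X := fun p =>
    ⟨empiricalMeasure (F p) (z p), isProbabilityMeasure_empiricalMeasure (hFne p) (z p)⟩
  let 𝒰 : Ultrafilter (Finset G × ℕ) := Ultrafilter.of atTop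
  have h𝒰 : (𝒰 : Filter (Finset G × ℕ)) ≤ atTop := Ultrafilter.of_le _
  obtain ⟨μ, -, hμ⟩ := isCompact_univ.ultrafilter_le_nhds (𝒰.map m) (by simp)
  have hlim : ∀ C : Set X, IsClopen C →
      Tendsto (fun p => (m p : Measure X) C) 𝒰 (𝓝 ((μ : Measure X) C)) := fun C hC =>
    ProbabilityMeasure.tendsto_measure_of_null_frontier_of_tendsto' (Ω := X) hμ
      (by rw [hC.frontier_eq, measure_empty])
  have hn : Tendsto (fun p : Finset G × ℕ => ((p.2 : ℝ≥0∞) + 1)⁻¹) 𝒰 (𝓝 0) := by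
    have h1 : Tendsto (fun p : Finset G × ℕ => p.2) 𝒰 atTop :=
      tendsto_snd.mono_left (h𝒰.trans prod_atTop_atTop_eq.ge)
    have h2 := (ENNReal.tendsto_inv_nat_nhds_zero.comp (tendsto_add_atTop_nat 1)).comp h1
    simpa [Function.comp_def] using h2
  have hinv : SMulInvariantMeasure G X (μ : Measure X) := by
    refine smulInvariantMeasure_of_isClopen hX _ fun g C hC => ?_
    have h := (hlim C hC).add hn
    rw [add_zero] at h
    refine le_of_tendsto_of_tendsto (hlim _ (hC.preimage (continuous_const_smul g))) h ?_
    filter_upwards [h𝒰 (eventually_ge_atTop (({g} : Finset G), 0))] with p hp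
    exact empiricalMeasure_preimage_smul_le (hFne p) (z p)
      (hF p g (hp.1 (Finset.mem_singleton_self g))) hC.isOpen.measurableSet
  refine (hAB μ inferInstance hinv).not_ge (le_of_tendsto_of_tendsto (hlim B hB) (hlim A hA) ?_)
  refine Eventually.of_forall fun p => ?_
  change empiricalMeasure _ _ _ ≤ empiricalMeasure _ _ _
  rw [empiricalMeasure_apply _ _ hA.isOpen.measurableSet,
    empiricalMeasure_apply _ _ hB.isOpen.measurableSet]
  exact mul_le_mul' le_rfl (by exact_mod_cast hz p)

/-! ### Clopen matchings and alternating paths -/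

section Matching

variable {G X ι : Type*} [Group G] [MulAction G X]

/-- A clopen partial matching of `A` into `B`: the points of `P i` are matched with their images
under `g i`. The sets `A` and `B` may overlap; a point of `A ∩ B` then plays two unrelated roles. -/
structure IsMatching [TopologicalSpace X] (g : ι → G) (A B : Set X) (P : ι → Set X) : Prop where
  isClopen : ∀ i, IsClopen (P i)
  subset : ∀ i, P i ⊆ A
  mem : ∀ {i x}, x ∈ P i → g i • x ∈ B
  eq_of_mem : ∀ {i j x}, x ∈ P i → x ∈ P j → i = j
  eq_of_smul_eq : ∀ {i j x y}, x ∈ P i → y ∈ P j → g i • x = g j • y → i = j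

/-- The points of `A` that are not matched by `P`. -/
def unmatched (A : Set X) (P : ι → Set X) : Set X := {x ∈ A | ∀ i, x ∉ P i}

/-- The word `w` leads from `b ∈ B` along an alternating path to a point of `B` not used by the
matching: a letter `i` means passing from a point of `B` to the point `x` of `A` matched with it,
and on to `g i • x`. -/
def AltPath (g : ι → G) (B : Set X) (P : ι → Set X) : List ι → X → Prop
  | [], b => b ∈ B ∧ ∀ j, (g j)⁻¹ • b ∉ P j
  | i :: w, b => ∃ j, (g j)⁻¹ • b ∈ P j ∧ AltPath g B P w (g i • (g j)⁻¹ • b)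

/-- A labelling of `B` by lower bounds for the lengths of alternating paths, in the form of local
inequalities. -/
structure IsLabelling (g : ι → G) (B : Set X) (P : ι → Set X) (r : X → ℕ) : Prop where
  eq_zero : ∀ {b}, b ∈ B → (∀ j, (g j)⁻¹ • b ∉ P j) → r b = 0
  le_succ : ∀ {i j x}, x ∈ P j → g i • x ∈ B → r (g j • x) ≤ r (g i • x) + 1

variable {g : ι → G} {A B : Set X} {P : ι → Set X} {r : X → ℕ}

theorem AltPath.mem [TopologicalSpace X] (hP : IsMatching g A B P) {w : List ι} {b : X}
    (h : AltPath g B P w b) : b ∈ B := by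
  cases w with
  | nil => exact h.1
  | cons i w =>
    obtain ⟨j, hj, -⟩ := h
    simpa using hP.mem hj

theorem IsLabelling.le_length [TopologicalSpace X] (hP : IsMatching g A B P)
    (hr : IsLabelling g B P r) {w : List ι} {b : X} (h : AltPath g B P w b) : r b ≤ w.length := by
  induction w generalizing b with
  | nil => exact (hr.eq_zero h.1 h.2).le
  | cons i w ih =>
    obtain ⟨j, hj, hw⟩ := h
    have h1 := hr.le_succ hj (hw.mem hP)
    rw [smul_inv_smul] at h1
    have h2 := ih hw
    simp only [List.length_cons]
    omega

theorem isClopen_unmatched [TopologicalSpace X] [Finite ι] (hA : IsClopen A)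
    (hP : IsMatching g A B P) : IsClopen (unmatched A P) := by
  have : unmatched A P = A ∩ ⋂ i, (P i)ᶜ := by
    ext x; simp [unmatched]
  rw [this]
  exact hA.inter (isClopen_iInter_of_finite fun i => (hP.isClopen i).compl)

theorem isClopen_setOf_altPath [TopologicalSpace X] [ContinuousConstSMul G X] [Finite ι]
    (hP : IsMatching g A B P) (hB : IsClopen B) (w : List ι) :
    IsClopen {b | AltPath g B P w b} := by
  induction w with
  | nil =>
    have : {b | AltPath g B P [] b} = B ∩ ⋂ j, ((g j)⁻¹ • ·) ⁻¹' (P j)ᶜ := by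
      ext b; simp [AltPath]
    rw [this]
    exact hB.inter (isClopen_iInter_of_finite fun j =>
      (hP.isClopen j).compl.preimage (continuous_const_smul _))
  | cons i w ih =>
    have : {b | AltPath g B P (i :: w) b} = ⋃ j, (((g j)⁻¹ • ·) ⁻¹' (P j) ∩
        (fun b => g i • (g j)⁻¹ • b) ⁻¹' {b | AltPath g B P w b}) := by
      ext b; simp [AltPath]
    rw [this]
    exact isClopen_iUnion_of_finite fun j =>
      ((hP.isClopen j).preimage (continuous_const_smul _)).inter
        (ih.preimage ((continuous_const_smul _).comp (continuous_const_smul _)))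

/-! ### Pushing along one letter -/

/-- The matching obtained from `P` by matching the points of `E` through `g i`, at the expense of
the points previously matched with points of `g i • E`. -/
def push (g : ι → G) (P : ι → Set X) (i : ι) (E : Set X) (l : ι) : Set X :=
  {x | (x ∈ P l ∧ (g i)⁻¹ • g l • x ∉ E) ∨ (l = i ∧ x ∈ E)}

/-- The points that lose their partner in `push g P i E`. -/
def displaced (g : ι → G) (P : ι → Set X) (i : ι) (E : Set X) : Set X :=
  {x | ∃ l, x ∈ P l ∧ (g i)⁻¹ • g l • x ∈ E}

theorem isClopen_displaced [TopologicalSpace X] [ContinuousConstSMul G X] [Finite ι]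
    (hP : IsMatching g A B P) {E : Set X} (hE : IsClopen E) (i : ι) :
    IsClopen (displaced g P i E) := by
  have : displaced g P i E = ⋃ l, (P l ∩ (fun x => (g i)⁻¹ • g l • x) ⁻¹' E) := by
    ext x; simp [displaced]
  rw [this]
  exact isClopen_iUnion_of_finite fun l => (hP.isClopen l).inter
    (hE.preimage ((continuous_const_smul _).comp (continuous_const_smul _)))

theorem IsMatching.push [TopologicalSpace X] [ContinuousConstSMul G X]
    (hP : IsMatching g A B P) {E : Set X} (hE : IsClopen E) (hEA : E ⊆ unmatched A P) {i : ι}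
    (hEB : ∀ x ∈ E, g i • x ∈ B) : IsMatching g A B (push g P i E) where
  isClopen l := by
    have h1 : IsClopen {x | x ∈ P l ∧ (g i)⁻¹ • g l • x ∉ E} := (hP.isClopen l).inter
      (hE.compl.preimage ((continuous_const_smul _).comp (continuous_const_smul _)))
    by_cases hl : l = i
    · have : DynamicalComparison.push g P i E l = {x | x ∈ P l ∧ (g i)⁻¹ • g l • x ∉ E} ∪ E := by
        ext x; simp [DynamicalComparison.push, hl]
      rw [this]
      exact h1.union hE
    · have : DynamicalComparison.push g P i E l = {x | x ∈ P l ∧ (g i)⁻¹ • g l • x ∉ E} := by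
        ext x; simp [DynamicalComparison.push, hl]
      rwa [this]
  subset l := by
    rintro x (⟨hx, -⟩ | ⟨-, hx⟩)
    · exact hP.subset l hx
    · exact (hEA hx).1
  mem := by
    rintro l x (⟨hx, -⟩ | ⟨rfl, hx⟩)
    · exact hP.mem hx
    · exact hEB x hx
  eq_of_mem := by
    rintro l k x (⟨hx, -⟩ | ⟨rfl, hx⟩) (⟨hx', -⟩ | ⟨rfl, hx'⟩)
    · exact hP.eq_of_mem hx hx'
    · exact absurd hx ((hEA hx').2 _)
    · exact absurd hx' ((hEA hx).2 _)
    · rfl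
  eq_of_smul_eq := by
    rintro l k x y (⟨hx, hx'⟩ | ⟨rfl, hx⟩) (⟨hy, hy'⟩ | ⟨rfl, hy⟩) h
    · exact hP.eq_of_smul_eq hx hy h
    · rw [h, inv_smul_smul] at hx'
      exact absurd hy hx'
    · rw [← h, inv_smul_smul] at hy'
      exact absurd hx hy'
    · rfl

theorem unmatched_push {E : Set X} {i : ι} {x : X} (h : x ∈ unmatched A (push g P i E)) :
    x ∈ unmatched A P ∧ x ∉ E ∨ x ∈ displaced g P i E := by
  have hxE : x ∉ E := fun hx => h.2 i (Or.inr ⟨rfl, hx⟩)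
  by_cases hx : ∃ l, x ∈ P l
  · obtain ⟨l, hl⟩ := hx
    refine Or.inr ⟨l, hl, ?_⟩
    by_contra hE
    exact h.2 l (Or.inl ⟨hl, hE⟩)
  · exact Or.inl ⟨⟨h.1, fun l hl => hx ⟨l, hl⟩⟩, hxE⟩

theorem displaced_subset_unmatched_push [TopologicalSpace X] (hP : IsMatching g A B P) {E : Set X}
    (hEA : E ⊆ unmatched A P) (i : ι) :
    displaced g P i E ⊆ unmatched A (push g P i E) := by
  rintro x ⟨l, hl, hE⟩
  refine ⟨hP.subset l hl, ?_⟩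
  rintro k (⟨hk, hk'⟩ | ⟨rfl, hx⟩)
  · rw [hP.eq_of_mem hl hk] at hE
    exact hk' hE
  · exact (hEA hx).2 _ hl

/-- The matched pairs of `push g P i E` at a point `b`. -/
theorem mem_push_inv_smul {E : Set X} {i j : ι} {b : X} :
    (g j)⁻¹ • b ∈ push g P i E j ↔
      ((g j)⁻¹ • b ∈ P j ∧ (g i)⁻¹ • b ∉ E) ∨ (j = i ∧ (g i)⁻¹ • b ∈ E) := by
  simp only [push, Set.mem_ofPred_eq, smul_inv_smul]
  constructor <;> rintro (h | ⟨rfl, h⟩)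
  all_goals first | exact Or.inl h | exact Or.inr ⟨rfl, h⟩

/-- Pushes of unmatched points all of whose neighbours have label at least `m` to points with label
`m` respect the labelling. -/
theorem IsLabelling.push (hr : IsLabelling g B P r) {E : Set X} {i : ι} {m : ℕ}
    (hm : ∀ x ∈ E, r (g i • x) = m) (hm' : ∀ x ∈ E, ∀ j, g j • x ∈ B → m ≤ r (g j • x)) :
    IsLabelling g B (push g P i E) r where
  eq_zero := by
    intro b hb h
    refine hr.eq_zero hb fun j hj => ?_
    by_cases hE : (g i)⁻¹ • b ∈ E
    · exact h i (mem_push_inv_smul.2 (Or.inr ⟨rfl, hE⟩))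
    · exact h j (mem_push_inv_smul.2 (Or.inl ⟨hj, hE⟩))
  le_succ := by
    rintro k j x (⟨hx, -⟩ | ⟨rfl, hx⟩) hB
    · exact hr.le_succ hx hB
    · rw [hm x hx]
      exact (hm' x hx k hB).trans (Nat.le_succ _)

/-- A push creates no alternating path of minimal length: such a path would have to descend from
label `m` to `m - 1` through a point of `E`. -/
theorem AltPath.of_push [TopologicalSpace X] {E : Set X} {i : ι} {m : ℕ}
    (hP' : IsMatching g A B (push g P i E))
    (hr' : IsLabelling g B (push g P i E) r)
    (hm : ∀ x ∈ E, r (g i • x) = m) (hm' : ∀ x ∈ E, ∀ j, g j • x ∈ B → m ≤ r (g j • x))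
    {w : List ι} {b : X} (hb : r b = w.length) (h : AltPath g B (push g P i E) w b) :
    AltPath g B P w b := by
  induction w generalizing b with
  | nil =>
    refine ⟨h.1, fun j hj => ?_⟩
    by_cases hE : (g i)⁻¹ • b ∈ E
    · exact h.2 i (mem_push_inv_smul.2 (Or.inr ⟨rfl, hE⟩))
    · exact h.2 j (mem_push_inv_smul.2 (Or.inl ⟨hj, hE⟩))
  | cons k w ih =>
    obtain ⟨j, hj, hw⟩ := h
    have hle := hr'.le_length hP' hw
    rw [List.length_cons] at hb
    rcases mem_push_inv_smul.1 hj with ⟨hjP, -⟩ | ⟨rfl, hjE⟩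
    · have h1 := hr'.le_succ hj (hw.mem hP')
      rw [smul_inv_smul] at h1
      exact ⟨j, hjP, ih (by omega) hw⟩
    · have h1 := hm _ hjE
      have h2 := hm' _ hjE k (hw.mem hP')
      rw [smul_inv_smul] at h1
      omega

/-- Alternating paths of minimal length below label `m` survive a push. -/
theorem AltPath.push [TopologicalSpace X] (hP : IsMatching g A B P) (hr : IsLabelling g B P r)
    {E : Set X} {i : ι} {m : ℕ} (hm : ∀ x ∈ E, r (g i • x) = m)
    {w : List ι} {b : X} (hb : r b = w.length) (hbm : r b < m) (h : AltPath g B P w b) :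
    AltPath g B (push g P i E) w b := by
  have hE : (g i)⁻¹ • b ∉ E := fun hE => by
    have := hm _ hE
    rw [smul_inv_smul] at this
    omega
  induction w generalizing b with
  | nil =>
    refine ⟨h.1, fun j hj => ?_⟩
    rcases mem_push_inv_smul.1 hj with ⟨hj, -⟩ | ⟨-, hj⟩
    · exact h.2 j hj
    · exact hE hj
  | cons k w ih =>
    obtain ⟨j, hj, hw⟩ := h
    have hle := hr.le_length hP hw
    have h1 := hr.le_succ hj (hw.mem hP)
    rw [smul_inv_smul] at h1
    rw [List.length_cons] at hb
    refine ⟨j, mem_push_inv_smul.2 (Or.inl ⟨hj, hE⟩), ih (by omega) (by omega) hw fun hE' => ?_⟩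
    have := hm _ hE'
    rw [smul_inv_smul] at this
    omega

/-! ### Augmentation -/

/-- All points of `E` can be matched simultaneously if one word describes a shortest alternating
path for each of them. Shortest paths with the same word cannot interfere: where two of them meet,
the labels agree, so they meet at the same letter, and then their starting points are equal. The
proof pushes `E` along the first edge and continues with the displaced points. -/
theorem IsMatching.exists_augment [TopologicalSpace X] [ContinuousConstSMul G X] [Finite ι]
    (w : List ι) {P : ι → Set X} (hP : IsMatching g A B P) (hr : IsLabelling g B P r) (i : ι)
    {E : Set X} (hE : IsClopen E) (hEA : E ⊆ unmatched A P)
    (hpath : ∀ x ∈ E, AltPath g B P w (g i • x))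
    (hmin : ∀ x ∈ E, ∀ j, g j • x ∈ B → w.length ≤ r (g j • x)) :
    ∃ P', IsMatching g A B P' ∧ IsLabelling g B P' r ∧ unmatched A P' ⊆ unmatched A P \ E ∧
      ∀ (w' : List ι) (b : X), r b = w'.length → AltPath g B P' w' b → AltPath g B P w' b := by
  induction w generalizing P i E with
  | nil =>
    have hm : ∀ x ∈ E, r (g i • x) = 0 := fun x hx => (hr.eq_zero (hpath x hx).1 (hpath x hx).2)
    have hP₁ := hP.push hE hEA fun x hx => (hpath x hx).1
    have hr₁ := hr.push hm hmin
    refine ⟨_, hP₁, hr₁, fun x hx => ?_, fun w' b hb h => h.of_push hP₁ hr₁ hm hmin hb⟩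
    rcases unmatched_push hx with h | ⟨l, hl, hlE⟩
    · exact h
    · refine absurd ?_ ((hpath _ hlE).2 l)
      rwa [smul_inv_smul, inv_smul_smul]
  | cons k w ih =>
    have hB : ∀ x ∈ E, g i • x ∈ B := fun x hx => (hpath x hx).mem hP
    have hm : ∀ x ∈ E, r (g i • x) = (k :: w).length := fun x hx =>
      (hr.le_length hP (hpath x hx)).antisymm (hmin x hx i (hB x hx))
    have hP₁ := hP.push hE hEA hB
    have hr₁ := hr.push hm hmin
    have hlen : (k :: w).length = w.length + 1 := rfl
    have hmin' : ∀ x ∈ displaced g P i E, ∀ j, g j • x ∈ B → w.length ≤ r (g j • x) := by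
      rintro x ⟨l, hl, hlE⟩ j hj
      have h1 := hr.le_succ hl hj
      have h2 := hm _ hlE
      rw [smul_inv_smul] at h2
      omega
    obtain ⟨P', hP', hr', hU, hback⟩ := ih hP₁ hr₁ k (isClopen_displaced hP hE i)
      (displaced_subset_unmatched_push hP hEA i) (by
        rintro x hx
        obtain ⟨l, hl, hlE⟩ := id hx
        obtain ⟨j, hj, hw⟩ := hpath _ hlE
        rw [smul_inv_smul] at hj hw
        obtain rfl := hP.eq_of_smul_eq hl hj (by rw [smul_inv_smul])
        rw [inv_smul_smul] at hw
        have h1 := hr.le_length hP hw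
        have h2 := hmin' x hx k (hw.mem hP)
        exact hw.push hP hr hm (by omega) (by omega)) hmin'
    refine ⟨P', hP', hr', fun x hx => ?_,
      fun w' b hb h => (hback w' b hb h).of_push hP₁ hr₁ hm hmin hb⟩
    obtain ⟨h1, h2⟩ := hU hx
    exact (unmatched_push h1).resolve_right h2

/-- Augmenting along the words of length `t` one after another removes all alternating paths of
length `t` starting at unmatched points, if no shorter ones exist. -/
theorem IsMatching.exists_phase [TopologicalSpace X] [ContinuousConstSMul G X] [Finite ι]
    (hA : IsClopen A) (hB : IsClopen B) (hP : IsMatching g A B P) (hr : IsLabelling g B P r)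
    {t : ℕ} (ht : ∀ x ∈ unmatched A P, ∀ j, g j • x ∈ B → t ≤ r (g j • x)) :
    ∃ P', IsMatching g A B P' ∧ IsLabelling g B P' r ∧ unmatched A P' ⊆ unmatched A P ∧
      ∀ x ∈ unmatched A P', ∀ (i : ι) (w : List ι), w.length = t →
        ¬ AltPath g B P' w (g i • x) := by
  have hfin : {p : ι × List ι | p.2.length = t}.Finite :=
    (Set.finite_univ.prod (List.finite_length_eq ι t)).subset fun p hp => ⟨trivial, hp⟩
  have key : ∃ P', IsMatching g A B P' ∧ IsLabelling g B P' r ∧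
      unmatched A P' ⊆ unmatched A P ∧ ∀ p ∈ {p : ι × List ι | p.2.length = t},
        ∀ x ∈ unmatched A P', ¬ AltPath g B P' p.2 (g p.1 • x) := by
    refine Set.Finite.induction_on_subset (motive := fun Q _ =>
      ∃ P', IsMatching g A B P' ∧ IsLabelling g B P' r ∧ unmatched A P' ⊆ unmatched A P ∧
        ∀ p ∈ Q, ∀ x ∈ unmatched A P', ¬ AltPath g B P' p.2 (g p.1 • x)) _ hfin
      ⟨P, hP, hr, subset_rfl, by simp⟩ ?_
    rintro p Q hpt hQt - ⟨P₁, hP₁, hr₁, hU₁, hQ⟩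
    replace hpt : p.2.length = t := hpt
    have hE : IsClopen (unmatched A P₁ ∩ (g p.1 • ·) ⁻¹' {b | AltPath g B P₁ p.2 b}) :=
      (isClopen_unmatched hA hP₁).inter
        ((isClopen_setOf_altPath hP₁ hB p.2).preimage (continuous_const_smul _))
    obtain ⟨P₂, hP₂, hr₂, hU₂, hback⟩ := hP₁.exists_augment p.2 hr₁ p.1 hE Set.inter_subset_left
      (fun x hx => hx.2) (fun x hx j hj => hpt ▸ ht x (hU₁ hx.1) j hj)
    refine ⟨P₂, hP₂, hr₂, fun x hx => hU₁ (hU₂ hx).1, fun q hq x hx hpath => ?_⟩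
    have hqt : q.2.length = t := by
      rcases Set.mem_insert_iff.1 hq with rfl | hq
      · exact hpt
      · exact hQt hq
    have h1 := hr₂.le_length hP₂ hpath
    have h2 := ht x (hU₁ (hU₂ hx).1) q.1 (hpath.mem hP₂)
    have h3 := hback q.2 _ (by omega) hpath
    rcases Set.mem_insert_iff.1 hq with rfl | hq
    · exact (hU₂ hx).2 ⟨(hU₂ hx).1, h3⟩
    · exact hQ q hq x (hU₂ hx).1 h3
  obtain ⟨P', h1, h2, h3, h4⟩ := key
  exact ⟨P', h1, h2, h3, fun x hx i w hw => h4 (i, w) hw x hx⟩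

/-- The minimal length of an alternating path starting at `b`, and `0` if there is none. -/
noncomputable def altDist (g : ι → G) (B : Set X) (P : ι → Set X) (b : X) : ℕ :=
  sInf {n | ∃ w : List ι, w.length = n ∧ AltPath g B P w b}

theorem exists_length_eq_altDist {w : List ι} {b : X} (h : AltPath g B P w b) :
    ∃ w' : List ι, w'.length = altDist g B P b ∧ AltPath g B P w' b :=
  Nat.sInf_mem (s := {n | ∃ w : List ι, w.length = n ∧ AltPath g B P w b}) ⟨_, w, rfl, h⟩

theorem altDist_le_length {w : List ι} {b : X} (h : AltPath g B P w b) :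
    altDist g B P b ≤ w.length :=
  Nat.sInf_le ⟨w, rfl, h⟩

theorem exists_altPath_of_mem {b : X} (hb : b ∈ B) (hP : ∀ i, P i ⊆ A)
    (hpath : ∀ x ∈ A, ∃ (i : ι) (w : List ι), AltPath g B P w (g i • x)) :
    ∃ w, AltPath g B P w b := by
  by_cases h : ∃ j, (g j)⁻¹ • b ∈ P j
  · obtain ⟨j, hj⟩ := h
    obtain ⟨i, w, hw⟩ := hpath _ (hP j hj)
    exact ⟨i :: w, j, hj, hw⟩
  · exact ⟨[], hb, fun j hj => h ⟨j, hj⟩⟩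

theorem isLabelling_altDist (hP : ∀ i, P i ⊆ A)
    (hpath : ∀ x ∈ A, ∃ (i : ι) (w : List ι), AltPath g B P w (g i • x)) :
    IsLabelling g B P (altDist g B P) where
  eq_zero hb h := Nat.le_zero.1 (altDist_le_length (w := []) ⟨hb, h⟩)
  le_succ := by
    intro i j x hx hB
    obtain ⟨w, hw⟩ := exists_altPath_of_mem hB hP hpath
    obtain ⟨w', hlen, hw'⟩ := exists_length_eq_altDist hw
    rw [← hlen]
    exact altDist_le_length (w := i :: w') ⟨j, by rwa [inv_smul_smul], by rwa [inv_smul_smul]⟩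

/-- If the points of `A` have alternating paths of bounded length with respect to every clopen
matching, then the bound is reached by finitely many augmentation phases: the `t`-th phase leaves
only alternating paths of length at least `t` from unmatched points, so in the end there are no
unmatched points. -/
theorem exists_isMatching_unmatched_eq_empty [TopologicalSpace X] [ContinuousConstSMul G X]
    [Finite ι] (hA : IsClopen A) (hB : IsClopen B) (g : ι → G) {N : ℕ}
    (hpath : ∀ P, IsMatching g A B P → ∀ x ∈ A,
      ∃ (i : ι) (w : List ι), w.length < N ∧ AltPath g B P w (g i • x)) :
    ∃ P, IsMatching g A B P ∧ unmatched A P = ∅ := by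
  have key : ∀ t : ℕ, ∃ P, IsMatching g A B P ∧ ∀ x ∈ unmatched A P, ∀ (i : ι) (w : List ι),
      w.length < t → ¬ AltPath g B P w (g i • x) := by
    intro t
    induction t with
    | zero =>
      refine ⟨fun _ => ∅, ⟨fun _ => isClopen_empty, fun _ => Set.empty_subset _, ?_, ?_, ?_⟩,
        fun _ _ _ _ h => absurd h (Nat.not_lt_zero _)⟩
      all_goals simp
    | succ t ih =>
      obtain ⟨P, hP, ht⟩ := ih
      have hpath' : ∀ x ∈ A, ∃ (i : ι) (w : List ι), AltPath g B P w (g i • x) := fun x hx => by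
        obtain ⟨i, w, -, hw⟩ := hpath P hP x hx
        exact ⟨i, w, hw⟩
      have hr := isLabelling_altDist hP.subset hpath'
      have hmin : ∀ x ∈ unmatched A P, ∀ j, g j • x ∈ B → t ≤ altDist g B P (g j • x) := by
        intro x hx j hj
        obtain ⟨w, hw⟩ := exists_altPath_of_mem hj hP.subset hpath'
        obtain ⟨w', hlen, hw'⟩ := exists_length_eq_altDist hw
        rw [← hlen]
        exact not_lt.1 fun h => ht x hx j w' h hw'
      obtain ⟨P', hP', hr', hU, hnone⟩ := hP.exists_phase hA hB hr hmin
      refine ⟨P', hP', fun x hx i w hw hw' => ?_⟩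
      have h1 := hr'.le_length hP' hw'
      have h2 := hmin x (hU hx) i (hw'.mem hP')
      exact hnone x hx i w (by omega) hw'
  obtain ⟨P, hP, h⟩ := key N
  refine ⟨P, hP, Set.eq_empty_of_forall_notMem fun x hx => ?_⟩
  obtain ⟨i, w, hlen, hw⟩ := hpath P hP x hx.1
  exact h x hx i w hlen hw

/-! ### Expansion -/

open scoped Classical in
/-- The points of `B` that can be matched with a point of `S`. -/
noncomputable def targets [Fintype ι] (g : ι → G) (B : Set X) (S : Finset X) : Finset X :=
  ((Finset.univ ×ˢ S).image fun p : ι × X => g p.1 • p.2).filter (· ∈ B)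

theorem mem_targets [Fintype ι] {S : Finset X} {b : X} :
    b ∈ targets g B S ↔ (∃ i, ∃ x ∈ S, g i • x = b) ∧ b ∈ B := by
  simp [targets]

/-- As long as alternating paths from `x` meet no unused point of `B`, the set of points of `A`
that they reach grows exponentially. -/
theorem exists_finset_of_no_altPath [TopologicalSpace X] [Fintype ι] [DecidableEq G]
    (hP : IsMatching g A B P) {c : ℝ} (hc : 0 ≤ c)
    (hexp : ∀ S : Finset X, (S : Set X) ⊆ A → c * S.card ≤ (targets g B S).card)
    {T : Finset G} (hT : ∀ i j, (g j)⁻¹ * g i ∈ T) {x : X} (hx : x ∈ A) (n : ℕ)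
    (hno : ∀ (i : ι) (w : List ι), w.length < n → ¬ AltPath g B P w (g i • x)) :
    ∃ S : Finset X, (S : Set X) ⊆ A ∧ c ^ n ≤ S.card ∧ (∀ y ∈ S, ∃ h ∈ T ^ n, h • x = y) ∧
      ∀ y ∈ S, ∀ (i : ι) (w : List ι), AltPath g B P w (g i • y) →
        ∃ (i' : ι) (w' : List ι), w'.length = w.length + n ∧ AltPath g B P w' (g i' • x) := by
  classical
  induction n with
  | zero =>
    refine ⟨{x}, by simpa using hx, by simp, by simp, fun y hy i w hw => ⟨i, w, rfl, ?_⟩⟩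
    rwa [← Finset.mem_singleton.1 hy]
  | succ n ih =>
    obtain ⟨S, hSA, hcard, hST, hSpath⟩ := ih fun i w hw => hno i w (by omega)
    have howner : ∀ b ∈ targets g B S, ∃ z j, z ∈ P j ∧ g j • z = b := by
      intro b hb
      obtain ⟨⟨i, y, hy, rfl⟩, hB⟩ := mem_targets.1 hb
      by_contra! hfree
      obtain ⟨i', w', hlen, hw'⟩ := hSpath y hy i []
        ⟨hB, fun j hj => hfree _ j hj (smul_inv_smul _ _)⟩
      rw [List.length_nil] at hlen
      exact hno i' w' (by omega) hw'
    have : Nonempty X := ⟨x⟩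
    choose! o ho using howner
    refine ⟨(targets g B S).image o, ?_, ?_, ?_, ?_⟩
    · intro z hz
      obtain ⟨b, hb, rfl⟩ := Finset.mem_image.1 (Finset.mem_coe.1 hz)
      obtain ⟨j, hj, -⟩ := ho b hb
      exact hP.subset _ hj
    · rw [Finset.card_image_of_injOn]
      · calc c ^ (n + 1) = c * c ^ n := pow_succ' c n
          _ ≤ c * S.card := by gcongr
          _ ≤ _ := hexp S hSA
      · intro b hb b' hb' h
        obtain ⟨j, hj, hjb⟩ := ho b hb
        obtain ⟨j', hj', hjb'⟩ := ho b' hb'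
        rw [← h] at hj' hjb'
        rw [← hjb, ← hjb', hP.eq_of_mem hj hj']
    · intro z hz
      obtain ⟨b, hb, rfl⟩ := Finset.mem_image.1 hz
      obtain ⟨j, -, hjb⟩ := ho b hb
      obtain ⟨⟨i, y, hy, hyb⟩, -⟩ := mem_targets.1 hb
      obtain ⟨h, hh, rfl⟩ := hST y hy
      refine ⟨(g j)⁻¹ * g i * h, ?_, ?_⟩
      · rw [pow_succ']
        exact Finset.mul_mem_mul (hT _ _) hh
      · rw [mul_smul, mul_smul, hyb, inv_smul_eq_iff, hjb]
    · intro z hz k w hw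
      obtain ⟨b, hb, rfl⟩ := Finset.mem_image.1 hz
      obtain ⟨j, hj, hjb⟩ := ho b hb
      obtain ⟨⟨i, y, hy, hyb⟩, -⟩ := mem_targets.1 hb
      have hz' : (g j)⁻¹ • g i • y = o b := by rw [hyb, inv_smul_eq_iff, hjb]
      obtain ⟨i', w', hlen, hw'⟩ := hSpath y hy i (k :: w) ⟨j, by rwa [hz'], by rwa [hz']⟩
      exact ⟨i', w', by rw [hlen, List.length_cons]; ring, hw'⟩

open scoped Classical in
/-- If all points visit `B` along `F` more often than `A`, then finite subsets of `A` expand by a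
fixed factor into `B`. This follows by counting the visits of all points `f⁻¹ • x`, `x ∈ S`. -/
theorem card_targets_of_window {F : Finset G}
    (hF : ∀ z : X, (F.filter fun f => f • z ∈ A).card < (F.filter fun f => f • z ∈ B).card)
    {S : Finset X} (hS : (S : Set X) ⊆ A) :
    (1 + ((F.card : ℝ) + 1)⁻¹) * S.card ≤
      (targets (fun p : F × F => (p.1 * (p.2 : G)⁻¹ : G)) B S).card := by
  rcases S.eq_empty_or_nonempty with rfl | ⟨x₀, hx₀⟩
  · simp
  set N := targets (fun p : F × F => (p.1 * (p.2 : G)⁻¹ : G)) B S with hN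
  have hF0 : F.Nonempty := by
    rw [Finset.nonempty_iff_ne_empty]
    rintro rfl
    simpa using hF x₀
  set Z : Finset X := (F ×ˢ S).image fun p => p.1⁻¹ • p.2 with hZ
  have hSZ : S.card ≤ Z.card := by
    obtain ⟨f, hf⟩ := hF0
    refine Finset.card_le_card_of_injOn (fun x => f⁻¹ • x) (fun x hx => ?_)
      (fun x _ y _ h => smul_left_cancel _ h)
    exact Finset.mem_image.2 ⟨(f, x), Finset.mk_mem_product hf hx, rfl⟩
  have hcount : ∀ C : Set X, ∑ z ∈ Z, (F.filter fun f => f • z ∈ C).card =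
      ∑ f ∈ F, (Z.filter fun z => f • z ∈ C).card := fun C =>
    (Finset.sum_card_bipartiteAbove_eq_sum_card_bipartiteBelow (fun z f => f • z ∈ C))
  have hA : F.card * S.card ≤ ∑ f ∈ F, (Z.filter fun z => f • z ∈ A).card := by
    rw [← smul_eq_mul]
    refine Finset.card_nsmul_le_sum _ _ _ fun f hf => ?_
    refine Finset.card_le_card_of_injOn (fun x => f⁻¹ • x) (fun x hx => ?_)
      (fun x _ y _ h => smul_left_cancel _ h)
    refine Finset.mem_coe.2 (Finset.mem_filter.2
      ⟨Finset.mem_image.2 ⟨(f, x), Finset.mk_mem_product hf hx, rfl⟩, ?_⟩)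
    simpa using hS hx
  have hB : ∑ f ∈ F, (Z.filter fun z => f • z ∈ B).card ≤ F.card * N.card := by
    rw [← smul_eq_mul]
    refine Finset.sum_le_card_nsmul _ _ _ fun f hf => ?_
    refine Finset.card_le_card_of_injOn (fun z => f • z) (fun z hz => ?_)
      (fun x _ y _ h => smul_left_cancel _ h)
    obtain ⟨hzZ, hzB⟩ := Finset.mem_filter.1 (Finset.mem_coe.1 hz)
    obtain ⟨⟨f', x⟩, hp, rfl⟩ := Finset.mem_image.1 hzZ
    obtain ⟨hf', hx⟩ := Finset.mem_product.1 hp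
    exact Finset.mem_coe.2 (mem_targets.2
      ⟨⟨(⟨f, hf⟩, ⟨f', hf'⟩), x, hx, by simp [mul_smul]⟩, hzB⟩)
  have hAB : ∑ z ∈ Z, (F.filter fun f => f • z ∈ A).card + Z.card ≤
      ∑ z ∈ Z, (F.filter fun f => f • z ∈ B).card := by
    rw [Finset.card_eq_sum_ones, ← Finset.sum_add_distrib]
    exact Finset.sum_le_sum fun z _ => hF z
  rw [hcount, hcount] at hAB
  have hnat : F.card * S.card + S.card ≤ F.card * N.card := by omega
  have hreal : (F.card : ℝ) * S.card + S.card ≤ F.card * N.card := by exact_mod_cast hnat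
  have hFpos : (0 : ℝ) < F.card := by exact_mod_cast hF0.card_pos
  have hle : ((F.card : ℝ) + 1)⁻¹ ≤ (F.card : ℝ)⁻¹ := by gcongr; linarith
  calc (1 + ((F.card : ℝ) + 1)⁻¹) * S.card ≤ (1 + (F.card : ℝ)⁻¹) * S.card := by gcongr
    _ = (F.card : ℝ)⁻¹ * (F.card * S.card + S.card) := by field_simp
    _ ≤ (F.card : ℝ)⁻¹ * (F.card * N.card) := by gcongr
    _ = N.card := by field_simp

/-! ### Comparison -/

theorem IsMatching.isSubequivalent [TopologicalSpace X] [Finite ι] (hP : IsMatching g A B P)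
    (hU : unmatched A P = ∅) : IsSubequivalent G A B := by
  obtain ⟨k, ⟨e⟩⟩ := Finite.exists_equiv_fin ι
  refine ⟨k, fun a => P (e.symm a), fun a => g (e.symm a), fun a => hP.isClopen _,
    fun a b hab => ?_, ?_, fun a => ?_, fun a b hab => ?_⟩
  · exact Set.disjoint_left.2 fun x hx hx' => hab (e.symm.injective (hP.eq_of_mem hx hx'))
  · refine Set.Subset.antisymm (Set.iUnion_subset fun a => hP.subset _) fun x hx => ?_
    by_contra h
    refine (Set.eq_empty_iff_forall_notMem.1 hU) x ⟨hx, fun i hi => h ?_⟩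
    exact Set.mem_iUnion.2 ⟨e i, by simpa using hi⟩
  · rintro _ ⟨x, hx, rfl⟩
    exact hP.mem hx
  · rw [Set.disjoint_left]
    rintro _ ⟨x, hx, rfl⟩ ⟨y, hy, h⟩
    exact hab (e.symm.injective (hP.eq_of_smul_eq hx hy h.symm))

theorem IsSubexponential.admitsComparison [MetricSpace X] [CompactSpace X] [MeasurableSpace X]
    [BorelSpace X] [ContinuousConstSMul G X] (hG : IsSubexponential G)
    (hX : IsZeroDimensional X) : AdmitsComparison G X := by
  classical
  intro A B hA hB hAB
  obtain ⟨F, hF⟩ := hG.exists_window hX hA hB hAB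
  let g : F × F → G := fun p => p.1 * (p.2 : G)⁻¹
  let T : Finset G := Finset.univ.image fun p : (F × F) × (F × F) => (g p.1)⁻¹ * g p.2
  -- The summand `1` beside `F.card` keeps this true for `F = ∅`, which occurs when `X` is empty.
  have hc : (1 : ℝ) < 1 + ((F.card : ℝ) + 1)⁻¹ := by
    have : (0 : ℝ) < ((F.card : ℝ) + 1)⁻¹ := by positivity
    linarith
  obtain ⟨n, hn⟩ := hG.exists_card_pow_lt T hc
  obtain ⟨P, hP, hU⟩ := exists_isMatching_unmatched_eq_empty (N := n) hA hB g fun P hP x hx => by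
    by_contra! hno
    obtain ⟨S, -, hcard, hST, -⟩ := exists_finset_of_no_altPath hP (zero_le_one.trans hc.le)
      (fun S hS => card_targets_of_window hF hS)
      (T := T) (fun i j => Finset.mem_image.2 ⟨(j, i), Finset.mem_univ _, rfl⟩) hx n hno
    have hsub : S ⊆ (T ^ n).image (· • x) := fun y hy => by
      obtain ⟨h, hh, rfl⟩ := hST y hy
      exact Finset.mem_image_of_mem _ hh
    have hle : (S.card : ℝ) ≤ (T ^ n).card := by
      exact_mod_cast (Finset.card_le_card hsub).trans Finset.card_image_le
    linarith
  exact hP.isSubequivalent hU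

end Matching

end DynamicalComparison

theorem mainTheorem2 (G : Type u) [Group G] [Countable G]
    (hG : DynamicalComparison.IsSubexponential G) :
    DynamicalComparison.HasComparisonProperty.{u, v} G := by
  intro X _ _ _ _ _ _ hX
  exact hG.admitsComparison hX
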